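/- **Setting.** Let $\Omega\subset\mathbb R^d$ be a bounded open set (the case of interest is a Lipschitz domain with $d=2,3$), $\varepsilon>0$, $f(r)=r^3-r$, $h(r)=r^3$. Write $(\cdot,\cdot)$ for the $L^2(\Omega)$ inner product, extended to $\int_\Omega g\varphi\,dx$ whenever $g\varphi$ is integrable. Let $\mathcal A=-\Delta$ with homogeneous Neumann condition in weak form, i.e. $\mathcal A:H^1(\Omega)\to H^1(\Omega)^*$, $\langle\mathcal Av,\varphi\rangle=(\nabla v,\nabla\varphi)$; functions $g\in L^2(\Omega)$ are identified with $v\mapsto(g,v)$ in $H^1(\Omega)^*$. *Exact solution.* $u,w:[0,T]\to H^1(\Omega)$ satisfy $u(0)=u_0$; $u$ is continuous on $[0,T]$ and differentiable on $(0,T]$ (one-sidedly at $T$) as a function with values in $H^1(\Omega)^*$; and for every $t\in(0,T]$: $f(u(t))\varphi\in L^1(\Omega)$ for all $\varphi\in H^1(\Omega)$ (automatic for Lipschitz domains with $d\le 3$) and $$\langle u_t,v\rangle+(\nabla w,\nabla v)=0,\qquad \varepsilon(\nabla u,\nabla\varphi)+\tfrac1\varepsilon(f(u),\varphi)-(w,\varphi)=0\qquad\forall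 v,\varphi\in H^1(\Omega).$$ *Discretization.* Let $0=t_0<t_1<\dots<t_N=T$, $\tau_n=t_n-t_{n-1}$ for $1\le n\le N$, $t_{n-\frac12}=\frac12(t_{n-1}+t_n)$, and let $\tau_0>0$ be arbitrary. For $0\le n\le N$ let $\mathcal T^n$ be a triangulation of $\Omega$ and $V_h^n=\{v\in H^1(\Omega): v|_K\in P_1(K)\ \forall K\in\mathcal T^n\}$. Let $P^n:L^2(\Omega)\to V_h^n$ be the $L^2$-projection and $A^n:V_h^n\to V_h^n$ the discrete Laplacian, $(A^nv,\Phi)=(\nabla v,\nabla\Phi)$ for all $\Phi\in V_h^n$. Let $u_h^n,w_h^n\in V_h^n$ $(0\le n\le N)$ satisfy $u_h^0=P^0u_0$ and, for $1\le n\le N$, the Crank–Nicolson scheme $$\frac{u_h^n-u_h^{n-1}}{\tau_n}+\frac{A^nw_h^n+A^{n-1}w_h^{n-1}}2=0,$$ $$\frac\varepsilon2\left(A^nu_h^n+A^{n-1}u_h^{n-1}\right)+\frac{P^nf(u_h^n)+P^{n-1}f(u_h^{n-1})}{2\varepsilon}-\frac{w_h^n+w_h^{n-1}}2=0.$$ (For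 a step with $V_h^n=V_h^{n-1}$ this is equivalent to its variational form: $\big(\frac{u_h^n-u_h^{n-1}}{\tau_n},v_h\big)+\frac12(\nabla w_h^n+\nabla w_h^{n-1},\nabla v_h)=0$ and $\frac\varepsilon2(\nabla u_h^n+\nabla u_h^{n-1},\nabla\varphi_h)+\frac1\varepsilon\big(\frac{f(u_h^n)+f(u_h^{n-1})}2,\varphi_h\big)-\frac12(w_h^n+w_h^{n-1},\varphi_h)=0$ for all $v_h,\varphi_h\in V_h^n$; such a step may be given in either form.) *Reconstructions.* For $0\le n\le N$ let $p^n=R^nu_h^n$, $q^n=R^nw_h^n\in H^1(\Omega)$ be the elliptic reconstructions, i.e. $h(p^n)\varphi\in L^1(\Omega)$ for all $\varphi\in H^1(\Omega)$ (again automatic for Lipschitz domains with $d\le3$) and, in weak form tested with all of $H^1(\Omega)$, $$\mathcal Aq^n+q^n=A^nw_h^n+w_h^n,\qquad \varepsilon\mathcal Ap^n+\tfrac1\varepsilon h(p^n)-q^n=\varepsilon A^nu_h^n+\tfrac1\varepsilon P^nh(u_h^n)-w_h^n .$$ For a sequence $(\nu^n)$, with $\nu^{-1}:=\nu^0$, put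 $$\partial_n^2\nu=\frac{\frac{\nu^n-\nu^{n-1}}{\tau_n}-\frac{\nu^{n-1}-\nu^{n-2}}{\tau_{n-1}}}{\frac{\tau_n+\tau_{n-1}}2},\qquad \nu(t)=\frac{t-t_{n-1}}{\tau_n}\nu^n+\frac{t_n-t}{\tau_n}\nu^{n-1}+\frac12(t-t_{n-1})(t-t_n)\,\partial_n^2\nu\quad(t_{n-1}\le t\le t_n).$$ Let $u_h(t),p(t),q(t)$ be these reconstructions of $(u_h^n),(p^n),(q^n)$, and set $e_u=u_h(t)-u(t)$, $\rho_u=p(t)-u(t)$, $\rho_w=q(t)-w(t)$. **Theorem (parabolic error identity).** For each $n=1,\dots,N$ and each $t\in(t_{n-1},t_n]$, $e_u$ is differentiable at $t$ as a function on $(t_{n-1},t_n]$ with values in $H^1(\Omega)^*$ (so $\partial_te_u$ is the left derivative at $t=t_n$), $(f(u)-f(p^n))\varphi$ is integrable for all $\varphi\in H^1(\Omega)$, and, as functionals on $H^1(\Omega)$, $$\partial_te_u+\mathcal A\rho_w=\frac{A^nw_h^n-A^{n-1}w_h^{n-1}}2+\mathcal A(q(t)-q^n)+w_h^n-R^nw_h^n+(t-t_{n-\frac12})\,\partial_n^2u_h,$$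 $$\begin{aligned}\varepsilon\mathcal A\rho_u-\rho_w={}&\varepsilon\frac{A^nu_h^n-A^{n-1}u_h^{n-1}}2+\frac{P^nf(u_h^n)-P^{n-1}f(u_h^{n-1})}{2\varepsilon}-\frac{w_h^n-w_h^{n-1}}2\\&+\varepsilon\mathcal A(p(t)-p^n)-(q(t)-q^n)+\frac{f(u)-f(p^n)}\varepsilon+\frac1\varepsilon(u_h^n-p^n).\end{aligned}$$ -/

import Mathlib

open MeasureTheory Set Filter Topology
open scoped ContDiff ENNReal InnerProductSpace

noncomputable section

namespace CahnHilliard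

variable {d : ℕ}

/-! ### The Sobolev space `H¹(Ω)` and its dual -/

/-- The space `L²(Ω)` of real functions on an open set `Ω ⊆ ℝᵈ`. -/
abbrev L2 (Ω : TopologicalSpace.Opens (EuclideanSpace ℝ (Fin d))) : Type :=
  Lp ℝ 2 (volume.restrict (Ω : Set (EuclideanSpace ℝ (Fin d))))

/-- The space `L²(Ω; ℝᵈ)` of vector fields. -/
abbrev L2Vec (Ω : TopologicalSpace.Opens (EuclideanSpace ℝ (Fin d))) : Type :=
  Lp (EuclideanSpace ℝ (Fin d)) 2 (volume.restrict (Ω : Set (EuclideanSpace ℝ (Fin d))))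

/-- `G` is the weak gradient of `f` on `Ω`: integration by parts against every smooth function
with compact support in `Ω`. -/
def IsWeakGradient (Ω : TopologicalSpace.Opens (EuclideanSpace ℝ (Fin d)))
    (f : L2 Ω) (G : L2Vec Ω) : Prop :=
  ∀ φ : EuclideanSpace ℝ (Fin d) → ℝ, ContDiff ℝ ∞ φ → HasCompactSupport φ →
    tsupport φ ⊆ (Ω : Set (EuclideanSpace ℝ (Fin d))) → ∀ i : Fin d,
      ∫ x in (Ω : Set (EuclideanSpace ℝ (Fin d))), f x * fderiv ℝ φ x (EuclideanSpace.single i 1) =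
        -∫ x in (Ω : Set (EuclideanSpace ℝ (Fin d))), G x i * φ x

lemma memLp_test (Ω : TopologicalSpace.Opens (EuclideanSpace ℝ (Fin d)))
    {φ : EuclideanSpace ℝ (Fin d) → ℝ} (h : Continuous φ) (hc : HasCompactSupport φ) :
    MemLp φ 2 (volume.restrict (Ω : Set (EuclideanSpace ℝ (Fin d)))) :=
  (h.memLp_of_hasCompactSupport hc).restrict _

lemma integrable_mul_test (Ω : TopologicalSpace.Opens (EuclideanSpace ℝ (Fin d))) (f : L2 Ω)
    {φ : EuclideanSpace ℝ (Fin d) → ℝ} (h : Continuous φ) (hc : HasCompactSupport φ) :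
    IntegrableOn (fun x => f x * φ x) (Ω : Set (EuclideanSpace ℝ (Fin d))) :=
  (Lp.memLp f).integrable_mul (memLp_test Ω h hc)

lemma memLp_coord (Ω : TopologicalSpace.Opens (EuclideanSpace ℝ (Fin d))) (G : L2Vec Ω)
    (i : Fin d) :
    MemLp (fun x => G x i) 2 (volume.restrict (Ω : Set (EuclideanSpace ℝ (Fin d)))) :=
  ((EuclideanSpace.proj i : EuclideanSpace ℝ (Fin d) →L[ℝ] ℝ).comp_memLp' (Lp.memLp G))

lemma integrable_coord_mul_test (Ω : TopologicalSpace.Opens (EuclideanSpace ℝ (Fin d)))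
    (G : L2Vec Ω) (i : Fin d)
    {φ : EuclideanSpace ℝ (Fin d) → ℝ} (h : Continuous φ) (hc : HasCompactSupport φ) :
    IntegrableOn (fun x => G x i * φ x) (Ω : Set (EuclideanSpace ℝ (Fin d))) :=
  (memLp_coord Ω G i).integrable_mul (memLp_test Ω h hc)

lemma continuous_partial {φ : EuclideanSpace ℝ (Fin d) → ℝ} (h : ContDiff ℝ ∞ φ) (i : Fin d) :
    Continuous (fun x => fderiv ℝ φ x (EuclideanSpace.single i 1)) :=
  (h.continuous_fderiv (by simp)).clm_apply continuous_const

lemma hasCompactSupport_partial {φ : EuclideanSpace ℝ (Fin d) → ℝ} (h : HasCompactSupport φ)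
    (i : Fin d) : HasCompactSupport (fun x => fderiv ℝ φ x (EuclideanSpace.single i 1)) :=
  h.fderiv_apply (𝕜 := ℝ) _

/-- The Sobolev space `H¹(Ω)`: pairs `(v, ∇v)` of an `L²` function and its weak gradient, with the
inner product `(u, v) + (∇u, ∇v)` inherited from `L²(Ω) × L²(Ω; ℝᵈ)`. -/
def H1 (Ω : TopologicalSpace.Opens (EuclideanSpace ℝ (Fin d))) :
    Submodule ℝ (WithLp 2 (L2 Ω × L2Vec Ω)) where
  carrier := {z | IsWeakGradient Ω z.fst z.snd}
  zero_mem' := by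
    intro φ h hc hs i
    have h1 := Lp.coeFn_zero ℝ 2 (volume.restrict (Ω : Set (EuclideanSpace ℝ (Fin d))))
    have h2 := Lp.coeFn_zero (EuclideanSpace ℝ (Fin d)) 2
      (volume.restrict (Ω : Set (EuclideanSpace ℝ (Fin d))))
    rw [integral_eq_zero_of_ae, integral_eq_zero_of_ae, neg_zero]
    · filter_upwards [h2] with x hx
      simp only [WithLp.zero_snd, hx]
      simp
    · filter_upwards [h1] with x hx
      simp only [WithLp.zero_fst, hx]
      simp
  add_mem' := by
    intro a b ha hb φ h hc hs i
    have h1 := Lp.coeFn_add a.fst b.fst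
    have h2 := Lp.coeFn_add a.snd b.snd
    have e1 : ∫ x in (Ω : Set (EuclideanSpace ℝ (Fin d))),
        (a + b).fst x * fderiv ℝ φ x (EuclideanSpace.single i 1) =
        ∫ x in (Ω : Set (EuclideanSpace ℝ (Fin d))),
          (a.fst x * fderiv ℝ φ x (EuclideanSpace.single i 1) +
            b.fst x * fderiv ℝ φ x (EuclideanSpace.single i 1)) := by
      refine integral_congr_ae ?_
      filter_upwards [h1] with x hx
      simp only [WithLp.add_fst, hx, Pi.add_apply, add_mul]
    have e2 : ∫ x in (Ω : Set (EuclideanSpace ℝ (Fin d))), (a + b).snd x i * φ x =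
        ∫ x in (Ω : Set (EuclideanSpace ℝ (Fin d))), (a.snd x i * φ x + b.snd x i * φ x) := by
      refine integral_congr_ae ?_
      filter_upwards [h2] with x hx
      simp only [WithLp.add_snd, hx, Pi.add_apply, PiLp.add_apply, add_mul]
    rw [e1, e2,
      integral_add
        (integrable_mul_test Ω _ (continuous_partial h i) (hasCompactSupport_partial hc i))
        (integrable_mul_test Ω _ (continuous_partial h i) (hasCompactSupport_partial hc i)),
      integral_add (integrable_coord_mul_test Ω _ i h.continuous hc)
        (integrable_coord_mul_test Ω _ i h.continuous hc), ha φ h hc hs i, hb φ h hc hs i]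
    ring
  smul_mem' := by
    intro c a ha φ h hc hs i
    have h1 := Lp.coeFn_smul c a.fst
    have h2 := Lp.coeFn_smul c a.snd
    have e1 : ∫ x in (Ω : Set (EuclideanSpace ℝ (Fin d))),
        (c • a).fst x * fderiv ℝ φ x (EuclideanSpace.single i 1) =
        ∫ x in (Ω : Set (EuclideanSpace ℝ (Fin d))),
          c * (a.fst x * fderiv ℝ φ x (EuclideanSpace.single i 1)) := by
      refine integral_congr_ae ?_
      filter_upwards [h1] with x hx
      simp only [WithLp.smul_fst, hx, Pi.smul_apply, smul_eq_mul, mul_assoc]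
    have e2 : ∫ x in (Ω : Set (EuclideanSpace ℝ (Fin d))), (c • a).snd x i * φ x =
        ∫ x in (Ω : Set (EuclideanSpace ℝ (Fin d))), c * (a.snd x i * φ x) := by
      refine integral_congr_ae ?_
      filter_upwards [h2] with x hx
      simp only [WithLp.smul_snd, hx, Pi.smul_apply, PiLp.smul_apply, smul_eq_mul, mul_assoc]
    rw [e1, e2, integral_const_mul, integral_const_mul, ha φ h hc hs i]
    ring

variable {Ω : TopologicalSpace.Opens (EuclideanSpace ℝ (Fin d))}

/-- The inclusion `H¹(Ω) → L²(Ω)`. -/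
def toL2 : H1 Ω →L[ℝ] L2 Ω := (WithLp.fstL 2 ℝ (L2 Ω) (L2Vec Ω)).comp (H1 Ω).subtypeL

/-- The weak gradient `H¹(Ω) → L²(Ω; ℝᵈ)`. -/
def grad : H1 Ω →L[ℝ] L2Vec Ω := (WithLp.sndL 2 ℝ (L2 Ω) (L2Vec Ω)).comp (H1 Ω).subtypeL

/-- An `L²` function as the functional `v ↦ (g, v)` on `H¹(Ω)`. -/
def pair (g : L2 Ω) : StrongDual ℝ (H1 Ω) := (innerSL ℝ g).comp toL2

/-- The operator `𝒜 = -Δ` with homogeneous Neumann condition, as the map from `H¹(Ω)` to its dual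
given by `⟨𝒜 v, φ⟩ = (∇v, ∇φ)`. -/
def lap (v : H1 Ω) : StrongDual ℝ (H1 Ω) := (innerSL ℝ (grad v)).comp grad

/-- The pairing `(g, φ) = ∫_Ω g φ` of a function with an element of `H¹(Ω)`. -/
def integralPair (Ω : TopologicalSpace.Opens (EuclideanSpace ℝ (Fin d)))
    (g : EuclideanSpace ℝ (Fin d) → ℝ) (φ : H1 Ω) : ℝ :=
  ∫ x in (Ω : Set (EuclideanSpace ℝ (Fin d))), g x * toL2 φ x

/-- The product `g φ` is integrable on `Ω` for every `φ ∈ H¹(Ω)`. -/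
def PairsWithH1 (Ω : TopologicalSpace.Opens (EuclideanSpace ℝ (Fin d)))
    (g : EuclideanSpace ℝ (Fin d) → ℝ) : Prop :=
  ∀ φ : H1 Ω, IntegrableOn (fun x => g x * toL2 φ x) (Ω : Set (EuclideanSpace ℝ (Fin d)))

/-- The weak gradient is determined by the function. -/
lemma eq_zero_of_toL2_eq_zero {v : H1 Ω} (hv : toL2 v = 0) : v = 0 := by
  have key : (v : WithLp 2 (L2 Ω × L2Vec Ω)).snd = 0 := by
    have hcoord : ∀ i : Fin d, ∀ᵐ x ∂(volume.restrict (Ω : Set (EuclideanSpace ℝ (Fin d)))),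
        (v : WithLp 2 (L2 Ω × L2Vec Ω)).snd x i = 0 := by
      intro i
      rw [ae_restrict_iff' Ω.isOpen.measurableSet]
      refine Ω.isOpen.ae_eq_zero_of_integral_contDiff_smul_eq_zero ?_ ?_
      · have hm := memLp_coord Ω (v : WithLp 2 (L2 Ω × L2Vec Ω)).snd i
        rw [locallyIntegrableOn_iff Ω.isOpen.isLocallyClosed]
        intro k hk hkc
        have hmk := hm.restrict k
        rw [Measure.restrict_restrict hkc.measurableSet, inter_eq_left.2 hk] at hmk
        have : IsFiniteMeasure (volume.restrict k) := ⟨by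
          simpa using hkc.measure_lt_top⟩
        exact hmk.integrable (by norm_num)
      · intro g hg hgc hgs
        have h := v.2 g hg hgc hgs i
        have h0 : (v : WithLp 2 (L2 Ω × L2Vec Ω)).fst = 0 := hv
        have hz : ∫ x in (Ω : Set (EuclideanSpace ℝ (Fin d))),
            (v : WithLp 2 (L2 Ω × L2Vec Ω)).fst x *
              fderiv ℝ g x (EuclideanSpace.single i 1) = 0 := by
          rw [h0]
          refine integral_eq_zero_of_ae ?_
          filter_upwards [Lp.coeFn_zero ℝ 2
            (volume.restrict (Ω : Set (EuclideanSpace ℝ (Fin d))))] with x hx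
          rw [hx]
          simp
        rw [hz] at h
        rw [← setIntegral_eq_integral_of_forall_compl_eq_zero
          (s := (Ω : Set (EuclideanSpace ℝ (Fin d))))]
        · simp_rw [smul_eq_mul, mul_comm (g _)]
          linarith
        · intro x hx
          rw [image_eq_zero_of_notMem_tsupport (fun h' => hx (hgs h')), zero_smul]
    refine (Lp.eq_zero_iff_ae_eq_zero).2 ?_
    filter_upwards [ae_all_iff.2 hcoord] with x hx
    ext i
    simpa using hx i
  apply Subtype.ext
  apply WithLp.ofLp_injective
  exact Prod.ext hv key

/-! ### Triangulations and piecewise linear finite elements -/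

/-- A triangulation of `Ω`: a finite conforming complex of simplices with union `closure Ω`, in
which every simplex is a face of a `d`-dimensional one. -/
structure Triangulation (Ω : TopologicalSpace.Opens (EuclideanSpace ℝ (Fin d))) extends
    Geometry.SimplicialComplex ℝ (EuclideanSpace ℝ (Fin d)) where
  finite_faces : faces.Finite
  pure_faces : ∀ s ∈ faces, ∃ K ∈ faces, s ⊆ K ∧ K.card = d + 1
  space_eq : toSimplicialComplex.space = closure (Ω : Set (EuclideanSpace ℝ (Fin d)))

/-- The elements of a triangulation: its `d`-dimensional simplices, given by their vertices. -/
def Triangulation.cells (𝒯 : Triangulation Ω) : Set (Finset (EuclideanSpace ℝ (Fin d))) :=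
  {K | K ∈ 𝒯.faces ∧ K.card = d + 1}

lemma Triangulation.finite_cells (𝒯 : Triangulation Ω) : 𝒯.cells.Finite :=
  𝒯.finite_faces.subset fun _ h => h.1

lemma Triangulation.exists_cell (𝒯 : Triangulation Ω) {x : EuclideanSpace ℝ (Fin d)}
    (hx : x ∈ closure (Ω : Set (EuclideanSpace ℝ (Fin d)))) :
    ∃ K ∈ 𝒯.cells, x ∈ convexHull ℝ (K : Set (EuclideanSpace ℝ (Fin d))) := by
  rw [← 𝒯.space_eq, Geometry.SimplicialComplex.mem_space_iff] at hx
  obtain ⟨s, hs, hxs⟩ := hx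
  obtain ⟨K, hK, hsK, hc⟩ := 𝒯.pure_faces s hs
  exact ⟨K, ⟨hK, hc⟩, convexHull_mono (by exact_mod_cast hsK) hxs⟩

/-- `v` coincides with the affine function `g` almost everywhere on the simplex with vertices
`K`. -/
def AgreesOn (v : H1 Ω) (K : Finset (EuclideanSpace ℝ (Fin d)))
    (g : EuclideanSpace ℝ (Fin d) →ᵃ[ℝ] ℝ) : Prop :=
  ∀ᵐ x ∂(volume.restrict (Ω : Set (EuclideanSpace ℝ (Fin d)))),
    x ∈ convexHull ℝ (K : Set (EuclideanSpace ℝ (Fin d))) → toL2 v x = g x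

lemma AgreesOn.zero (K : Finset (EuclideanSpace ℝ (Fin d))) : AgreesOn (0 : H1 Ω) K 0 := by
  have h := Lp.coeFn_zero ℝ 2 (volume.restrict (Ω : Set (EuclideanSpace ℝ (Fin d))))
  unfold AgreesOn
  rw [map_zero]
  filter_upwards [h] with x hx _
  rw [hx]
  simp

lemma AgreesOn.add {v w : H1 Ω} {K : Finset (EuclideanSpace ℝ (Fin d))}
    {g k : EuclideanSpace ℝ (Fin d) →ᵃ[ℝ] ℝ} (h1 : AgreesOn v K g) (h2 : AgreesOn w K k) :
    AgreesOn (v + w) K (g + k) := by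
  unfold AgreesOn
  rw [map_add]
  filter_upwards [Lp.coeFn_add (toL2 v) (toL2 w), h1, h2] with x hx hx1 hx2 hxK
  rw [hx, Pi.add_apply, hx1 hxK, hx2 hxK]
  simp

lemma AgreesOn.smul {v : H1 Ω} {K : Finset (EuclideanSpace ℝ (Fin d))}
    {g : EuclideanSpace ℝ (Fin d) →ᵃ[ℝ] ℝ} (c : ℝ) (h1 : AgreesOn v K g) :
    AgreesOn (c • v) K (c • g) := by
  unfold AgreesOn
  rw [map_smul]
  filter_upwards [Lp.coeFn_smul c (toL2 v), h1] with x hx hx1 hxK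
  rw [hx, Pi.smul_apply, hx1 hxK]
  simp

/-- The finite element space `V_h = {v ∈ H¹(Ω) : v|_K ∈ P₁(K) for every element K}`. -/
def P1 (𝒯 : Triangulation Ω) : Submodule ℝ (H1 Ω) where
  carrier := {v | ∀ K ∈ 𝒯.cells, ∃ g : EuclideanSpace ℝ (Fin d) →ᵃ[ℝ] ℝ, AgreesOn v K g}
  zero_mem' := fun K _ => ⟨0, AgreesOn.zero K⟩
  add_mem' := by
    intro a b ha hb K hK
    obtain ⟨g, hg⟩ := ha K hK
    obtain ⟨k, hk⟩ := hb K hK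
    exact ⟨g + k, hg.add hk⟩
  smul_mem' := by
    intro c a ha K hK
    obtain ⟨g, hg⟩ := ha K hK
    exact ⟨c • g, hg.smul c⟩

instance finiteDimensional_P1 (𝒯 : Triangulation Ω) : FiniteDimensional ℝ (P1 𝒯) := by
  classical
  have : Finite 𝒯.cells := 𝒯.finite_cells
  let W : Submodule ℝ (H1 Ω × (𝒯.cells → (EuclideanSpace ℝ (Fin d) →ᵃ[ℝ] ℝ))) :=
    { carrier := {z | ∀ K : 𝒯.cells, AgreesOn z.1 K.1 (z.2 K)}
      zero_mem' := fun K => AgreesOn.zero K.1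
      add_mem' := fun ha hb K => (ha K).add (hb K)
      smul_mem' := fun c _ ha K => (ha K).smul c }
  have : FiniteDimensional ℝ (EuclideanSpace ℝ (Fin d) →ᵃ[ℝ] ℝ) :=
    Module.Finite.equiv (AffineMap.toConstProdLinearMap (k := ℝ)
      (V1 := EuclideanSpace ℝ (Fin d)) (V2 := ℝ) ℝ).symm
  let toG : W →ₗ[ℝ] (𝒯.cells → (EuclideanSpace ℝ (Fin d) →ᵃ[ℝ] ℝ)) :=
    (LinearMap.snd ℝ _ _).comp W.subtype
  let toV : W →ₗ[ℝ] H1 Ω := (LinearMap.fst ℝ _ _).comp W.subtype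
  have hinj : Function.Injective toG := by
    rw [← LinearMap.ker_eq_bot, LinearMap.ker_eq_bot']
    rintro ⟨⟨v, g⟩, hz⟩ h0
    have hg : g = 0 := h0
    subst hg
    have hv : v = 0 := by
      apply eq_zero_of_toL2_eq_zero
      refine (Lp.eq_zero_iff_ae_eq_zero).2 ?_
      filter_upwards [ae_all_iff.2 hz, ae_restrict_mem Ω.isOpen.measurableSet] with x hx hxΩ
      obtain ⟨K, hK, hxK⟩ := 𝒯.exists_cell (subset_closure hxΩ)
      simpa using hx ⟨K, hK⟩ hxK
    subst hv
    rfl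
  have : FiniteDimensional ℝ W := FiniteDimensional.of_injective toG hinj
  have hle : P1 𝒯 ≤ LinearMap.range toV := by
    intro v hv
    choose g hg using fun K : 𝒯.cells => hv K.1 K.2
    exact ⟨⟨⟨v, g⟩, hg⟩, rfl⟩
  exact Submodule.finiteDimensional_of_le hle

/-- Finite element functions are bounded. -/
lemma exists_bound (𝒯 : Triangulation Ω) (v : P1 𝒯) :
    ∃ C : ℝ, ∀ᵐ x ∂(volume.restrict (Ω : Set (EuclideanSpace ℝ (Fin d)))),
      ‖toL2 (v : H1 Ω) x‖ ≤ C := by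
  classical
  have : Finite 𝒯.cells := 𝒯.finite_cells
  choose g hg using fun K : 𝒯.cells => v.2 K.1 K.2
  have hb : ∀ K : 𝒯.cells, ∃ C : ℝ,
      ∀ x ∈ convexHull ℝ (K.1 : Set (EuclideanSpace ℝ (Fin d))), ‖g K x‖ ≤ C := fun K =>
    (K.1.finite_toSet.isCompact_convexHull ℝ).exists_bound_of_continuousOn
      (g K).continuous_of_finiteDimensional.continuousOn
  choose C hC using hb
  obtain ⟨M, hM⟩ := (Set.finite_range C).bddAbove
  refine ⟨M, ?_⟩
  filter_upwards [ae_all_iff.2 hg, ae_restrict_mem Ω.isOpen.measurableSet] with x hx hxΩ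
  obtain ⟨K, hK, hxK⟩ := 𝒯.exists_cell (subset_closure hxΩ)
  rw [hx ⟨K, hK⟩ hxK]
  exact (hC ⟨K, hK⟩ x hxK).trans (hM ⟨⟨K, hK⟩, rfl⟩)

lemma isFiniteMeasure_of_triangulation (𝒯 : Triangulation Ω) :
    IsFiniteMeasure (volume.restrict (Ω : Set (EuclideanSpace ℝ (Fin d)))) := by
  refine ⟨?_⟩
  rw [Measure.restrict_apply_univ]
  have hc : IsCompact (closure (Ω : Set (EuclideanSpace ℝ (Fin d)))) := by
    rw [← 𝒯.space_eq]
    exact 𝒯.finite_faces.isCompact_biUnion fun s _ => s.finite_toSet.isCompact_convexHull ℝ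
  exact (measure_mono subset_closure).trans_lt hc.measure_lt_top

lemma memLp_cube (𝒯 : Triangulation Ω) (v : P1 𝒯) :
    MemLp (fun x => toL2 (v : H1 Ω) x ^ 3) 2
      (volume.restrict (Ω : Set (EuclideanSpace ℝ (Fin d)))) := by
  have := isFiniteMeasure_of_triangulation 𝒯
  obtain ⟨C, hC⟩ := exists_bound 𝒯 v
  refine MemLp.of_bound ((Lp.aestronglyMeasurable _).pow 3) (C ^ 3) ?_
  filter_upwards [hC] with x hx
  rw [norm_pow]
  exact pow_le_pow_left₀ (norm_nonneg _) hx 3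

/-- The nonlinearity `f(r) = r³ - r`. -/
def fCH (r : ℝ) : ℝ := r ^ 3 - r

/-- The nonlinearity `h(r) = r³`. -/
def hCH (r : ℝ) : ℝ := r ^ 3

/-- `h(v) ∈ L²(Ω)` for a finite element function `v`. -/
def hL2 (𝒯 : Triangulation Ω) (v : P1 𝒯) : L2 Ω :=
  MemLp.toLp (fun x => hCH (toL2 (v : H1 Ω) x)) (memLp_cube 𝒯 v)

/-- `f(v) ∈ L²(Ω)` for a finite element function `v`. -/
def fL2 (𝒯 : Triangulation Ω) (v : P1 𝒯) : L2 Ω :=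
  MemLp.toLp (fun x => fCH (toL2 (v : H1 Ω) x)) ((memLp_cube 𝒯 v).sub (Lp.memLp _))

/-- The `L²(Ω)` inner product on the finite element space. -/
def massForm (𝒯 : Triangulation Ω) : LinearMap.BilinForm ℝ (P1 𝒯) :=
  LinearMap.mk₂ ℝ (fun v w => ⟪toL2 (v : H1 Ω), toL2 (w : H1 Ω)⟫_ℝ)
    (by intros; simp [inner_add_left])
    (by intros; simp [inner_smul_left])
    (by intros; simp [inner_add_right])
    (by intros; simp [inner_smul_right])

lemma massForm_nondegenerate (𝒯 : Triangulation Ω) : (massForm 𝒯).Nondegenerate := by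
  have key : ∀ v : P1 𝒯, massForm 𝒯 v v = 0 → v = 0 := by
    intro v hv
    have h0 : toL2 (v : H1 Ω) = 0 := inner_self_eq_zero.1 (show
      ⟪toL2 (v : H1 Ω), toL2 (v : H1 Ω)⟫_ℝ = 0 from hv)
    exact Subtype.ext (eq_zero_of_toL2_eq_zero h0)
  exact ⟨fun v hv => key v (hv v), fun v hv => key v (hv v)⟩

/-- The element of the finite element space representing a functional in the `L²(Ω)` inner
product. -/
def riesz (𝒯 : Triangulation Ω) (ℓ : StrongDual ℝ (H1 Ω)) : P1 𝒯 :=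
  ((massForm 𝒯).toDual (massForm_nondegenerate 𝒯)).symm
    ((ℓ : H1 Ω →ₗ[ℝ] ℝ).comp (P1 𝒯).subtype)

lemma riesz_spec (𝒯 : Triangulation Ω) (ℓ : StrongDual ℝ (H1 Ω)) (Φ : P1 𝒯) :
    ⟪toL2 (riesz 𝒯 ℓ : H1 Ω), toL2 (Φ : H1 Ω)⟫_ℝ = ℓ (Φ : H1 Ω) :=
  LinearMap.BilinForm.apply_toDual_symm_apply (B := massForm 𝒯)
    (hB := massForm_nondegenerate 𝒯)
    ((ℓ : H1 Ω →ₗ[ℝ] ℝ).comp (P1 𝒯).subtype) Φ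

/-- The `L²(Ω)`-projection `P` onto the finite element space: `(P g, Φ) = (g, Φ)` for all
`Φ ∈ V_h`. -/
def proj (𝒯 : Triangulation Ω) (g : L2 Ω) : P1 𝒯 := riesz 𝒯 (pair g)

/-- The discrete Laplacian `A : V_h → V_h`: `(A v, Φ) = (∇v, ∇Φ)` for all `Φ ∈ V_h`. -/
def discLap (𝒯 : Triangulation Ω) (v : P1 𝒯) : P1 𝒯 := riesz 𝒯 (lap (v : H1 Ω))

/-! ### Weak solutions of the Cahn–Hilliard system -/

/-- `(u, w)` is a weak solution on `[0, T]` of `u_t + 𝒜 w = 0`, `ε 𝒜 u + f(u)/ε - w = 0` with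
homogeneous Neumann conditions and `u(0) = u₀`. The time derivative is that of `u` as a function
with values in the dual of `H¹(Ω)`; it is one-sided at `t = T`. -/
structure IsWeakSolution (ε T : ℝ) (u₀ : L2 Ω) (u w : ℝ → H1 Ω) : Prop where
  initial : toL2 (u 0) = u₀
  continuousOn : ContinuousOn (fun s => pair (toL2 (u s))) (Icc 0 T)
  differentiable : ∀ t ∈ Ioc 0 T,
    DifferentiableWithinAt ℝ (fun s => pair (toL2 (u s))) (Icc 0 T) t
  evolution : ∀ t ∈ Ioc 0 T, ∀ v : H1 Ω,
    derivWithin (fun s => pair (toL2 (u s))) (Icc 0 T) t v + lap (w t) v = 0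
  integrable : ∀ t ∈ Ioc 0 T, PairsWithH1 Ω (fun x => fCH (toL2 (u t) x))
  potential : ∀ t ∈ Ioc 0 T, ∀ φ : H1 Ω,
    ε * lap (u t) φ + 1 / ε * integralPair Ω (fun x => fCH (toL2 (u t) x)) φ
      - pair (toL2 (w t)) φ = 0

/-! ### The Crank–Nicolson scheme -/

/-- The time step `τ_n = t_n - t_{n-1}` for `n ≥ 1`; the value `τ_0`, which occurs only in the second
difference at `n = 1`, is a parameter. -/
def timeStep (t : ℕ → ℝ) (τ₀ : ℝ) : ℕ → ℝ
  | 0 => τ₀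
  | n + 1 => t (n + 1) - t n

/-- The `n`-th step (`n ≥ 1`) in pointwise form. -/
def PointwiseStep (ε : ℝ) (t : ℕ → ℝ) (𝒯 : ℕ → Triangulation Ω)
    (uh wh : (n : ℕ) → P1 (𝒯 n)) (n : ℕ) : Prop :=
  (1 / (t n - t (n - 1))) • ((uh n : H1 Ω) - (uh (n - 1) : H1 Ω))
      + (1 / 2 : ℝ) • ((discLap (𝒯 n) (wh n) : H1 Ω) + discLap (𝒯 (n - 1)) (wh (n - 1))) = 0 ∧
  (ε / 2) • ((discLap (𝒯 n) (uh n) : H1 Ω) + discLap (𝒯 (n - 1)) (uh (n - 1)))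
      + (1 / (2 * ε)) • ((proj (𝒯 n) (fL2 (𝒯 n) (uh n)) : H1 Ω)
          + proj (𝒯 (n - 1)) (fL2 (𝒯 (n - 1)) (uh (n - 1))))
      - (1 / 2 : ℝ) • ((wh n : H1 Ω) + (wh (n - 1) : H1 Ω)) = 0

/-- The `n`-th step (`n ≥ 1`) in variational form. -/
def VariationalStep (ε : ℝ) (t : ℕ → ℝ) (𝒯 : ℕ → Triangulation Ω)
    (uh wh : (n : ℕ) → P1 (𝒯 n)) (n : ℕ) : Prop :=
  (∀ v ∈ P1 (𝒯 n),
    pair (toL2 ((1 / (t n - t (n - 1))) • ((uh n : H1 Ω) - (uh (n - 1) : H1 Ω)))) v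
      + 1 / 2 * lap ((wh n : H1 Ω) + (wh (n - 1) : H1 Ω)) v = 0) ∧
  (∀ φ ∈ P1 (𝒯 n),
    ε / 2 * lap ((uh n : H1 Ω) + (uh (n - 1) : H1 Ω)) φ
      + 1 / ε * pair ((1 / 2 : ℝ) • (fL2 (𝒯 n) (uh n) + fL2 (𝒯 (n - 1)) (uh (n - 1)))) φ
      - 1 / 2 * pair (toL2 ((wh n : H1 Ω) + (wh (n - 1) : H1 Ω))) φ = 0)

/-- `(uʰ_n, wʰ_n)`, `0 ≤ n ≤ N`, solves the Crank–Nicolson finite element scheme with initial value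
`uʰ_0 = P⁰ u₀`. Each step is given in pointwise form, or in variational form if the finite element
space does not change in this step (the two forms are then equivalent). -/
structure IsCrankNicolson (ε : ℝ) (N : ℕ) (t : ℕ → ℝ) (u₀ : L2 Ω) (𝒯 : ℕ → Triangulation Ω)
    (uh wh : (n : ℕ) → P1 (𝒯 n)) : Prop where
  initial : uh 0 = proj (𝒯 0) u₀
  step : ∀ n, 1 ≤ n → n ≤ N →
    PointwiseStep ε t 𝒯 uh wh n ∨
      (P1 (𝒯 n) = P1 (𝒯 (n - 1)) ∧ VariationalStep ε t 𝒯 uh wh n)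

/-! ### Reconstructions in space and in time -/

/-- `(p, q) = (R χ, R ϑ)` is the elliptic reconstruction of `(χ, ϑ) ∈ V_h × V_h`: the weak solution
in `H¹(Ω)` of `𝒜 q + q = A ϑ + ϑ`, `ε 𝒜 p + h(p)/ε - q = ε A χ + P h(χ)/ε - ϑ` with homogeneous
Neumann conditions. -/
structure IsEllipticReconstruction (ε : ℝ) (𝒯 : Triangulation Ω) (χ ϑ : P1 𝒯) (p q : H1 Ω) :
    Prop where
  eq_q : ∀ v : H1 Ω, lap q v + pair (toL2 q) v =
    pair (toL2 (discLap 𝒯 ϑ : H1 Ω)) v + pair (toL2 (ϑ : H1 Ω)) v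
  integrable : PairsWithH1 Ω (fun x => hCH (toL2 p x))
  eq_p : ∀ φ : H1 Ω,
    ε * lap p φ + 1 / ε * integralPair Ω (fun x => hCH (toL2 p x)) φ - pair (toL2 q) φ =
      ε * pair (toL2 (discLap 𝒯 χ : H1 Ω)) φ
        + 1 / ε * pair (toL2 (proj 𝒯 (hL2 𝒯 χ) : H1 Ω)) φ - pair (toL2 (ϑ : H1 Ω)) φ

variable {X : Type*} [AddCommGroup X] [Module ℝ X]

/-- The second difference `∂²_n ν`, `n ≥ 1`. At `n = 1` the natural number `n - 2` is `0`, which is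
the convention `ν^{-1} = ν^0`. -/
def secondDiff (t : ℕ → ℝ) (τ₀ : ℝ) (ν : ℕ → X) (n : ℕ) : X :=
  (1 / ((timeStep t τ₀ n + timeStep t τ₀ (n - 1)) / 2)) •
    ((1 / timeStep t τ₀ n) • (ν n - ν (n - 1))
      - (1 / timeStep t τ₀ (n - 1)) • (ν (n - 1) - ν (n - 2)))

/-- The index `n ≥ 1` of the time interval containing `s`: the least `n ≥ 1` with `s ≤ t_n`. -/
def intervalIndex (t : ℕ → ℝ) (s : ℝ) : ℕ := sInf {n : ℕ | 1 ≤ n ∧ s ≤ t n}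

/-- The quadratic polynomial on the `n`-th time interval. -/
def quadPiece (t : ℕ → ℝ) (τ₀ : ℝ) (ν : ℕ → X) (n : ℕ) (s : ℝ) : X :=
  ((s - t (n - 1)) / timeStep t τ₀ n) • ν n + ((t n - s) / timeStep t τ₀ n) • ν (n - 1)
    + (1 / 2 * (s - t (n - 1)) * (s - t n)) • secondDiff t τ₀ ν n

/-- The continuous piecewise quadratic reconstruction in time of the sequence `ν`. -/
def timeRec (t : ℕ → ℝ) (τ₀ : ℝ) (ν : ℕ → X) (s : ℝ) : X :=
  quadPiece t τ₀ ν (intervalIndex t s) s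

/-- The difference between the time reconstruction of a sequence and a function of time. For the
sequences `uʰ_n`, `pⁿ`, `qⁿ` and the functions `u`, `u`, `w` these are the errors
`e_u = u_h(t) - u(t)`, `ρ_u = p(t) - u(t)`, `ρ_w = q(t) - w(t)`. -/
def recError (t : ℕ → ℝ) (τ₀ : ℝ) (ν : ℕ → X) (u : ℝ → X) (s : ℝ) : X :=
  timeRec t τ₀ ν s - u s

end CahnHilliard

end

/-! Both identities are algebra in the dual of H¹(Ω) once the time derivative is known. On (t_{n-1},
t_n] the reconstruction is a single quadratic, whose derivative is the difference quotient plus (t -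
t_{n-1/2}) times the second difference (`hasDerivAt_quadPiece`). The embedding of H¹(Ω) into its
dual is a continuous linear map, so it commutes with this derivative, and the equation replaces u_t
by -𝒜w (`differentiableWithinAt_recError`).

What remains compares a value at t_n with an average. The elliptic reconstruction expresses 𝒜qⁿ and
ε𝒜pⁿ through discrete quantities at level n alone, while the scheme says that certain averages over
the levels n-1 and n balance. Since a - (a + b)/2 = (a - b)/2, the half differences on the right
appear. The reconstruction involves h, whereas the scheme and the equation involve f = h - id; the
passage costs uⁿ_h on the discrete side (`proj_fL2`) and pⁿ on the continuous side
(`integralPair_fCH`), which together form the last term (uⁿ_h - pⁿ)/ε.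

Testing with all of H¹(Ω) requires the scheme as an equality of functions;
`VariationalStep.pointwiseStep` provides this when a step is given in variational form. -/

namespace CahnHilliard

variable {d : ℕ} {Ω : TopologicalSpace.Opens (EuclideanSpace ℝ (Fin d))}

/-! ### Linearity of the functionals on H¹(Ω) -/

lemma pair_apply (g : L2 Ω) (v : H1 Ω) : pair g v = ⟪g, toL2 v⟫_ℝ := rfl

lemma pair_add (g k : L2 Ω) (v : H1 Ω) : pair (g + k) v = pair g v + pair k v := by
  simp [pair_apply, inner_add_left]

lemma pair_sub (g k : L2 Ω) (v : H1 Ω) : pair (g - k) v = pair g v - pair k v := by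
  simp [pair_apply, inner_sub_left]

lemma pair_smul (c : ℝ) (g : L2 Ω) (v : H1 Ω) : pair (c • g) v = c * pair g v := by
  simp [pair_apply, inner_smul_left]

lemma pair_toL2_zero (v : H1 Ω) : pair (toL2 (0 : H1 Ω)) v = 0 := by
  simp [pair_apply]

lemma pair_toL2_add (a b v : H1 Ω) :
    pair (toL2 (a + b)) v = pair (toL2 a) v + pair (toL2 b) v := by
  rw [map_add, pair_add]

lemma pair_toL2_sub (a b v : H1 Ω) :
    pair (toL2 (a - b)) v = pair (toL2 a) v - pair (toL2 b) v := by
  rw [map_sub, pair_sub]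

lemma pair_toL2_smul (c : ℝ) (a v : H1 Ω) : pair (toL2 (c • a)) v = c * pair (toL2 a) v := by
  rw [map_smul, pair_smul]

lemma lap_apply (a v : H1 Ω) : lap a v = ⟪grad a, grad v⟫_ℝ := rfl

lemma lap_add (a b v : H1 Ω) : lap (a + b) v = lap a v + lap b v := by
  simp [lap_apply, inner_add_left]

lemma lap_sub (a b v : H1 Ω) : lap (a - b) v = lap a v - lap b v := by
  simp [lap_apply, inner_sub_left]

/-- The functional `v ↦ (g, v)` depends continuously and linearly on `g ∈ H¹(Ω)`. -/
noncomputable def pairCLM : H1 Ω →L[ℝ] StrongDual ℝ (H1 Ω) :=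
  (LinearMap.mkContinuous
    { toFun := pair
      map_add' := fun g k => ContinuousLinearMap.ext (pair_add g k)
      map_smul' := fun c g => ContinuousLinearMap.ext (pair_smul c g) }
    ‖(toL2 : H1 Ω →L[ℝ] L2 Ω)‖ fun g => by
      rw [mul_comm, ← innerSL_apply_norm ℝ g]
      exact ContinuousLinearMap.opNorm_comp_le _ _).comp toL2

lemma pairCLM_apply (g : H1 Ω) : pairCLM g = pair (toL2 g) := rfl

/-! ### Discrete operators and the pointwise form of the scheme -/

lemma pair_proj (𝒯 : Triangulation Ω) (g : L2 Ω) (Φ : P1 𝒯) :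
    pair (toL2 (proj 𝒯 g : H1 Ω)) Φ = pair g Φ := riesz_spec 𝒯 _ Φ

lemma pair_discLap (𝒯 : Triangulation Ω) (v Φ : P1 𝒯) :
    pair (toL2 (discLap 𝒯 v : H1 Ω)) Φ = lap (v : H1 Ω) Φ := riesz_spec 𝒯 _ Φ

/-- A finite element function that is `L²`-orthogonal to the finite element space vanishes. -/
lemma eq_zero_of_pair_eq_zero (𝒯 : Triangulation Ω) {z : H1 Ω} (hz : z ∈ P1 𝒯)
    (h : ∀ v ∈ P1 𝒯, pair (toL2 z) v = 0) : z = 0 :=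
  eq_zero_of_toL2_eq_zero (inner_self_eq_zero (𝕜 := ℝ).1 (h z hz))

/-- On a finite element space, `P f(v) = P h(v) - v`. -/
lemma proj_fL2 (𝒯 : Triangulation Ω) (v : P1 𝒯) :
    (proj 𝒯 (fL2 𝒯 v) : H1 Ω) = (proj 𝒯 (hL2 𝒯 v) : H1 Ω) - v := by
  have hf : fL2 𝒯 v = hL2 𝒯 v - toL2 (v : H1 Ω) := by
    -- Once v is written as the class of its own representative, both sides are classes of the same
    -- function by definition.
    conv_rhs => rw [← Lp.toLp_coeFn (toL2 (v : H1 Ω)) (Lp.memLp _)]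
    rfl
  rw [← sub_eq_zero]
  refine eq_zero_of_pair_eq_zero 𝒯
    (sub_mem (SetLike.coe_mem _) (sub_mem (SetLike.coe_mem _) (SetLike.coe_mem _)))
    fun Φ hΦ => ?_
  have h1 := pair_proj 𝒯 (fL2 𝒯 v) ⟨Φ, hΦ⟩
  have h2 := pair_proj 𝒯 (hL2 𝒯 v) ⟨Φ, hΦ⟩
  simp only [pair_toL2_sub, pair_sub, hf] at h1 h2 ⊢
  linarith

/-- If the finite element space does not change, the variational form of a step implies its
pointwise form. -/
lemma VariationalStep.pointwiseStep {ε : ℝ} {t : ℕ → ℝ} {𝒯 : ℕ → Triangulation Ω}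
    {uh wh : (n : ℕ) → P1 (𝒯 n)} {n : ℕ} (hV : P1 (𝒯 n) = P1 (𝒯 (n - 1)))
    (h : VariationalStep ε t 𝒯 uh wh n) : PointwiseStep ε t 𝒯 uh wh n := by
  -- The triangulations may differ; equality of the spaces is enough. It puts the residual of each
  -- equation into the test space, and it lets a test function be used with the discrete operators
  -- of both levels.
  have hm : ∀ z : P1 (𝒯 (n - 1)), (z : H1 Ω) ∈ P1 (𝒯 n) := fun z => hV.ge z.2
  have hm' : ∀ z : P1 (𝒯 n), (z : H1 Ω) ∈ P1 (𝒯 n) := fun z => z.2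
  constructor
  · refine eq_zero_of_pair_eq_zero (𝒯 n) (add_mem
      (Submodule.smul_mem _ _ (sub_mem (hm' _) (hm _)))
      (Submodule.smul_mem _ _ (add_mem (hm' _) (hm _)))) fun v hv => ?_
    have h0 := h.1 v hv
    have h1 := pair_discLap (𝒯 n) (wh n) ⟨v, hv⟩
    have h2 := pair_discLap (𝒯 (n - 1)) (wh (n - 1)) ⟨v, hV.le hv⟩
    simp only [pair_toL2_add, pair_toL2_sub, pair_toL2_smul, lap_add] at h0 h1 h2 ⊢
    rw [h1, h2]
    linarith
  · refine eq_zero_of_pair_eq_zero (𝒯 n) (sub_mem (add_mem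
      (Submodule.smul_mem _ _ (add_mem (hm' _) (hm _)))
      (Submodule.smul_mem _ _ (add_mem (hm' _) (hm _))))
      (Submodule.smul_mem _ _ (add_mem (hm' _) (hm _)))) fun v hv => ?_
    have h0 := h.2 v hv
    have h1 := pair_discLap (𝒯 n) (uh n) ⟨v, hv⟩
    have h2 := pair_discLap (𝒯 (n - 1)) (uh (n - 1)) ⟨v, hV.le hv⟩
    have h3 := pair_proj (𝒯 n) (fL2 (𝒯 n) (uh n)) ⟨v, hv⟩
    have h4 := pair_proj (𝒯 (n - 1)) (fL2 (𝒯 (n - 1)) (uh (n - 1))) ⟨v, hV.le hv⟩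
    simp only [pair_toL2_add, pair_toL2_sub, pair_toL2_smul, pair_add, pair_smul, lap_add]
      at h0 h1 h2 h3 h4 ⊢
    rw [h1, h2, h3, h4, ← h0]
    ring

/-- Removes the case distinction between the two forms of a step, so that the error identities need
only one. -/
lemma IsCrankNicolson.pointwiseStep {ε : ℝ} {N : ℕ} {t : ℕ → ℝ} {u₀ : L2 Ω}
    {𝒯 : ℕ → Triangulation Ω} {uh wh : (n : ℕ) → P1 (𝒯 n)}
    (h : IsCrankNicolson ε N t u₀ 𝒯 uh wh) {n : ℕ} (hn : 1 ≤ n) (hnN : n ≤ N) :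
    PointwiseStep ε t 𝒯 uh wh n :=
  (h.step n hn hnN).elim id fun h' => h'.2.pointwiseStep h'.1

/-! ### The time reconstruction and the derivative of the error -/

lemma timeStep_of_one_le (t : ℕ → ℝ) (τ₀ : ℝ) {n : ℕ} (hn : 1 ≤ n) :
    timeStep t τ₀ n = t n - t (n - 1) := by
  obtain ⟨m, rfl⟩ := Nat.exists_eq_add_of_le' hn
  rfl

lemma partition_le {N : ℕ} {t : ℕ → ℝ} (ht : ∀ n < N, t n < t (n + 1)) {m n : ℕ}
    (hmn : m ≤ n) (hn : n ≤ N) : t m ≤ t n := by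
  induction n, hmn using Nat.le_induction with
  | base => exact le_rfl
  | succ k _ ih => exact (ih (by omega)).trans (ht k (by omega)).le

/-- An index m < n is excluded because t_m ≤ t_{n-1} < s. The strict left inequality matters: at s =
t_{n-1} with n ≥ 2 the previous interval would be selected. -/
lemma intervalIndex_eq {N : ℕ} {t : ℕ → ℝ} (ht : ∀ n < N, t n < t (n + 1)) {n : ℕ}
    (hn : 1 ≤ n) (hnN : n ≤ N) {s : ℝ} (hs : s ∈ Ioc (t (n - 1)) (t n)) :
    intervalIndex t s = n := by
  refine IsLeast.csInf_eq ⟨⟨hn, hs.2⟩, fun m hm => ?_⟩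
  by_contra! hlt
  exact absurd (hs.1.trans_le hm.2) (partition_le ht (Nat.le_sub_one_of_lt hlt) (by omega)).not_gt

lemma timeRec_eq {X : Type*} [AddCommGroup X] [Module ℝ X] {N : ℕ} {t : ℕ → ℝ}
    (ht : ∀ n < N, t n < t (n + 1)) (τ₀ : ℝ) (ν : ℕ → X) {n : ℕ} (hn : 1 ≤ n) (hnN : n ≤ N)
    {s : ℝ} (hs : s ∈ Ioc (t (n - 1)) (t n)) : timeRec t τ₀ ν s = quadPiece t τ₀ ν n s := by
  rw [timeRec, intervalIndex_eq ht hn hnN hs]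

/-- The two linear weights contribute the difference quotient, and ½(s - t_{n-1})(s - t_n) has
derivative s - t_{n-1/2}. The second difference is a constant vector here, so τ₀ plays no role. A
fixed quadratic has a two-sided derivative everywhere; one-sidedness enters only when it is
identified with the reconstruction. -/
lemma hasDerivAt_quadPiece {X : Type*} [NormedAddCommGroup X] [NormedSpace ℝ X] (t : ℕ → ℝ)
    (τ₀ : ℝ) (ν : ℕ → X) {n : ℕ} (hn : 1 ≤ n) (s : ℝ) :
    HasDerivAt (quadPiece t τ₀ ν n)
      ((1 / (t n - t (n - 1))) • (ν n - ν (n - 1))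
        + (s - (t (n - 1) + t n) / 2) • secondDiff t τ₀ ν n) s := by
  have h1 := (((hasDerivAt_id s).sub_const (t (n - 1))).div_const (timeStep t τ₀ n)).smul_const
    (ν n)
  have h2 := (((hasDerivAt_id s).const_sub (t n)).div_const (timeStep t τ₀ n)).smul_const
    (ν (n - 1))
  have h3 := ((((hasDerivAt_id s).sub_const (t (n - 1))).const_mul (1 / 2)).mul
    ((hasDerivAt_id s).sub_const (t n))).smul_const (secondDiff t τ₀ ν n)
  refine ((h1.add h2).add h3).congr_deriv ?_
  rw [timeStep_of_one_le t τ₀ hn]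
  simp only [id]
  module

/-- The derivative of `L ∘ (g - c)` along a set `S` contained in a set `S'` on which `L ∘ c` is
differentiable. -/
lemma differentiableWithinAt_clm_comp_sub {X Y : Type*} [NormedAddCommGroup X] [NormedSpace ℝ X]
    [NormedAddCommGroup Y] [NormedSpace ℝ Y] (L : X →L[ℝ] Y) {g c e : ℝ → X} {g' : X}
    {S S' : Set ℝ} {s : ℝ} (hg : HasDerivAt g g' s)
    (hc : DifferentiableWithinAt ℝ (fun r => L (c r)) S' s)
    (hSS' : S ⊆ S') (hS : UniqueDiffWithinAt ℝ S s) (hs : s ∈ S)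
    (he : ∀ r ∈ S, e r = g r - c r) :
    DifferentiableWithinAt ℝ (fun r => L (e r)) S s ∧
      derivWithin (fun r => L (e r)) S s = L g' - derivWithin (fun r => L (c r)) S' s := by
  have key : ∀ r ∈ S, L (e r) = L (g r) - L (c r) := fun r hr => by rw [he r hr, map_sub]
  have h := (((L.hasFDerivAt.comp_hasDerivAt s hg).hasDerivWithinAt (s := S)).sub
    (hc.hasDerivWithinAt.mono hSS')).congr key (key s hs)
  exact ⟨h.differentiableWithinAt, h.derivWithin hS⟩

/-- The derivative of the error `e_u` on `(t_{n-1}, t_n]`, in the dual of `H¹(Ω)`. -/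
lemma differentiableWithinAt_recError {ε T : ℝ} {u₀ : L2 Ω} {u w : ℝ → H1 Ω}
    (hu : IsWeakSolution ε T u₀ u w) {N : ℕ} {t : ℕ → ℝ} (ht0 : t 0 = 0) (htN : t N = T)
    (ht : ∀ n < N, t n < t (n + 1)) (τ₀ : ℝ) (ν : ℕ → H1 Ω) {n : ℕ} (hn : 1 ≤ n) (hnN : n ≤ N)
    {s : ℝ} (hs : s ∈ Ioc (t (n - 1)) (t n)) :
    DifferentiableWithinAt ℝ (fun r => pair (toL2 (recError t τ₀ ν u r)))
      (Ioc (t (n - 1)) (t n)) s ∧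
    derivWithin (fun r => pair (toL2 (recError t τ₀ ν u r))) (Ioc (t (n - 1)) (t n)) s =
      pairCLM ((1 / (t n - t (n - 1))) • (ν n - ν (n - 1))
          + (s - (t (n - 1) + t n) / 2) • secondDiff t τ₀ ν n)
        - derivWithin (fun r => pair (toL2 (u r))) (Icc 0 T) s := by
  have hlo : 0 ≤ t (n - 1) := ht0 ▸ partition_le ht (Nat.zero_le _) (by omega)
  have hhi : t n ≤ T := htN ▸ partition_le ht hnN le_rfl
  have h := @differentiableWithinAt_clm_comp_sub (H1 Ω) (StrongDual ℝ (H1 Ω)) _ _ _ _ pairCLM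
    (quadPiece t τ₀ ν n) u (recError t τ₀ ν u) _ (Ioc (t (n - 1)) (t n)) (Icc 0 T) s
    (hasDerivAt_quadPiece t τ₀ ν hn s)
    (hu.differentiable s ⟨hlo.trans_lt hs.1, hs.2.trans hhi⟩)
    (fun r hr => ⟨hlo.trans hr.1.le, hr.2.trans hhi⟩) (uniqueDiffOn_Ioc _ _ s hs) hs
    (fun r hr => by rw [recError, timeRec_eq ht τ₀ ν hn hnN hr])
  -- `pairCLM` applied to a function is `pair` of its L² part by definition, so no rewriting is
  -- needed.
  exact h

/-- `f(v) φ = h(v) φ - v φ` is integrable if `h(v) φ` is. -/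
lemma PairsWithH1.fCH_of_hCH {v : H1 Ω} (h : PairsWithH1 Ω (fun x => hCH (toL2 v x))) :
    PairsWithH1 Ω (fun x => fCH (toL2 v x)) := fun φ =>
  ((h φ).sub ((Lp.memLp (toL2 v)).integrable_mul (Lp.memLp (toL2 φ)))).congr
    (.of_forall fun x => by simp [fCH, hCH, sub_mul])

/-! ### The cubic nonlinearity as a functional -/

lemma integralPair_toL2 (v φ : H1 Ω) :
    integralPair Ω (fun x => toL2 v x) φ = pair (toL2 v) φ := by
  rw [pair_apply, L2.inner_def]
  exact integral_congr_ae (.of_forall fun _ => mul_comm _ _)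

lemma integralPair_sub {g k : EuclideanSpace ℝ (Fin d) → ℝ} {φ : H1 Ω}
    (hg : IntegrableOn (fun x => g x * toL2 φ x) (Ω : Set (EuclideanSpace ℝ (Fin d))))
    (hk : IntegrableOn (fun x => k x * toL2 φ x) (Ω : Set (EuclideanSpace ℝ (Fin d)))) :
    integralPair Ω (fun x => g x - k x) φ = integralPair Ω g φ - integralPair Ω k φ := by
  simp only [integralPair, sub_mul]
  exact integral_sub hg hk

lemma PairsWithH1.sub {g k : EuclideanSpace ℝ (Fin d) → ℝ} (hg : PairsWithH1 Ω g)
    (hk : PairsWithH1 Ω k) : PairsWithH1 Ω (fun x => g x - k x) := fun φ =>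
  ((hg φ).sub (hk φ)).congr (.of_forall fun x => by simp [sub_mul])

/-- The continuous counterpart of `proj_fL2`, used for v = pⁿ. Such a v need not be bounded, so
integrability of h(v)φ has to be assumed in order to split the integral. -/
lemma integralPair_fCH {v : H1 Ω} (h : PairsWithH1 Ω (fun x => hCH (toL2 v x))) (φ : H1 Ω) :
    integralPair Ω (fun x => fCH (toL2 v x)) φ =
      integralPair Ω (fun x => hCH (toL2 v x)) φ - pair (toL2 v) φ := by
  rw [← integralPair_toL2]
  exact integralPair_sub (h φ) ((Lp.memLp (toL2 v)).integrable_mul (Lp.memLp (toL2 φ)))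

end CahnHilliard

/-! ### The error identities -/

open CahnHilliard in
theorem theorem3p1 {d : ℕ} {Ω : TopologicalSpace.Opens (EuclideanSpace ℝ (Fin d))}
    (ε T : ℝ) (hε : 0 < ε)
    -- the exact solution
    (u₀ : L2 Ω) (u w : ℝ → H1 Ω) (hu : IsWeakSolution ε T u₀ u w)
    -- the time partition `0 = t_0 < t_1 < ... < t_N = T`
    (N : ℕ) (t : ℕ → ℝ) (ht0 : t 0 = 0) (htN : t N = T) (ht : ∀ n < N, t n < t (n + 1))
    (τ₀ : ℝ) (hτ₀ : 0 < τ₀)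
    -- the discrete solution
    (𝒯 : ℕ → Triangulation Ω) (uh wh : (n : ℕ) → P1 (𝒯 n))
    (huh : IsCrankNicolson ε N t u₀ 𝒯 uh wh)
    -- the elliptic reconstructions `pⁿ = Rⁿ uʰ_n` and `qⁿ = Rⁿ wʰ_n`
    (p q : ℕ → H1 Ω)
    (hpq : ∀ n ≤ N, IsEllipticReconstruction ε (𝒯 n) (uh n) (wh n) (p n) (q n))
    (n : ℕ) (hn : 1 ≤ n) (hnN : n ≤ N) (s : ℝ) (hs : s ∈ Set.Ioc (t (n - 1)) (t n)) :
    -- `e_u` is differentiable at `s`, as a function on `(t_{n-1}, t_n]` with values in the dual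
    DifferentiableWithinAt ℝ
      (fun r => pair (toL2 (recError t τ₀ (fun k => (uh k : H1 Ω)) u r)))
      (Set.Ioc (t (n - 1)) (t n)) s ∧
    -- the first identity
    (∀ v : H1 Ω,
      derivWithin (fun r => pair (toL2 (recError t τ₀ (fun k => (uh k : H1 Ω)) u r)))
          (Set.Ioc (t (n - 1)) (t n)) s v
        + lap (recError t τ₀ q w s) v =
      pair (toL2 ((1 / 2 : ℝ) •
          ((discLap (𝒯 n) (wh n) : H1 Ω) - (discLap (𝒯 (n - 1)) (wh (n - 1)) : H1 Ω)))) v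
        + lap (timeRec t τ₀ q s - q n) v
        + pair (toL2 ((wh n : H1 Ω) - q n)) v
        + pair (toL2 ((s - (t (n - 1) + t n) / 2) •
            secondDiff t τ₀ (fun k => (uh k : H1 Ω)) n)) v) ∧
    -- the nonlinear residual is a well-defined functional
    PairsWithH1 Ω (fun x => fCH (toL2 (u s) x) - fCH (toL2 (p n) x)) ∧
    -- the second identity
    (∀ φ : H1 Ω,
      ε * lap (recError t τ₀ p u s) φ - pair (toL2 (recError t τ₀ q w s)) φ =
      ε * pair (toL2 ((1 / 2 : ℝ) •
          ((discLap (𝒯 n) (uh n) : H1 Ω) - (discLap (𝒯 (n - 1)) (uh (n - 1)) : H1 Ω)))) φ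
        + pair (toL2 ((1 / (2 * ε)) •
            ((proj (𝒯 n) (fL2 (𝒯 n) (uh n)) : H1 Ω)
              - (proj (𝒯 (n - 1)) (fL2 (𝒯 (n - 1)) (uh (n - 1))) : H1 Ω)))) φ
        - pair (toL2 ((1 / 2 : ℝ) • ((wh n : H1 Ω) - (wh (n - 1) : H1 Ω)))) φ
        + ε * lap (timeRec t τ₀ p s - p n) φ
        - pair (toL2 (timeRec t τ₀ q s - q n)) φ
        + 1 / ε * integralPair Ω (fun x => fCH (toL2 (u s) x) - fCH (toL2 (p n) x)) φ
        + 1 / ε * pair (toL2 ((uh n : H1 Ω) - p n)) φ) := by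
  have hlo : 0 ≤ t (n - 1) := ht0 ▸ partition_le ht (Nat.zero_le _) (by omega)
  have hhi : t n ≤ T := htN ▸ partition_le ht hnN le_rfl
  have hsT : s ∈ Set.Ioc 0 T := ⟨hlo.trans_lt hs.1, hs.2.trans hhi⟩
  obtain ⟨hdiff, hder⟩ :=
    differentiableWithinAt_recError hu ht0 htN ht τ₀ (fun k => (uh k : H1 Ω)) hn hnN hs
  have hrec := hpq n hnN
  obtain ⟨hstep₁, hstep₂⟩ := huh.pointwiseStep hn hnN
  have hfp := hrec.integrable.fCH_of_hCH
  refine ⟨hdiff, fun v => ?_, (hu.integrable s hsT).sub hfp, fun φ => ?_⟩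
  · rw [hder, sub_apply, pairCLM_apply]
    -- With a and b the discrete Laplacians of w_h at levels n and n-1: `h1` turns -u_t - 𝒜w into 0,
    -- `h3` gives -(a + b)/2 for the difference quotient, and `h2` gives 𝒜qⁿ = a + wⁿ_h - qⁿ. The
    -- sum contains (a - b)/2.
    have h1 := hu.evolution s hsT v
    have h2 := hrec.eq_q v
    have h3 := congrArg (fun z => pair (toL2 z) v) hstep₁
    simp only [recError, pair_toL2_add, pair_toL2_sub, pair_toL2_smul, pair_toL2_zero,
      lap_sub] at h1 h2 h3 ⊢
    linarith
  · have h1 := hu.potential s hsT φ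
    have h2 := hrec.eq_p φ
    have h3 := congrArg (fun z => pair (toL2 z) φ) hstep₂
    have h4 := congrArg (fun z => pair (toL2 z) φ) (proj_fL2 (𝒯 n) (uh n))
    rw [integralPair_sub (hu.integrable s hsT φ) (hfp φ), integralPair_fCH hrec.integrable]
    -- Brings the coefficient of the scheme to the form 1/ε used in the other equations, so that all
    -- of them are linear in the same quantities.
    have hε' : 1 / (2 * ε) = 1 / ε / 2 := by ring
    simp only [recError, pair_toL2_add, pair_toL2_sub, pair_toL2_smul, pair_toL2_zero,
      lap_sub, hε'] at h1 h2 h3 h4 ⊢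
    -- The level-n reconstruction, corrected by the vanishing average of the scheme, minus the exact
    -- equation; the last term trades P h(uⁿ_h) for P f(uⁿ_h) + uⁿ_h.
    linear_combination h2 + h3 - h1 - 1 / ε * h4
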